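/- Let $d\ge 1$ and let $\hat K\subset\mathbb R^d$ be a reference $d$-simplex with $|\hat K|=1$. There is a constant $C>0$, depending only on $d$ and $\hat K$, such that the following holds. **Setting.** Let $\Omega\subset\mathbb R^d$ be a nonempty open set and $\mathcal T_h$ a finite conforming simplicial triangulation of $\overline\Omega$ whose simplices resolve $\partial\Omega$ (i.e. $\partial\Omega$ is a union of simplices of the triangulation), with $N$ elements; for each element $K$ let $F_K:\hat K\to K$ be an affine bijection, with Jacobian matrix $F_K'$. Let $F=F(x,u,\nabla u)$ be smooth on $\overline\Omega\times\mathbb R\times\mathbb R^d$. Let $U_0^h$ be the space of continuous piecewise linear functions on $\mathcal T_h$ vanishing on $\partial\Omega$, and $W^h$ the span of the quadratic edge bubble functions $4\phi_a\phi_b$ of the edges $ab$ of $\mathcal T_h$ not contained in $\partial\Omega$, where $\phi_a$ denotes the piecewise linear hat function of the vertex $a$. Put $$\delta I[u,v]=\int_\Omega \big(F_u(x,u,\nabla u)\,v+F_{\nabla u}(x,u,\nabla u)\cdot\nabla v\big)\,dx,$$ and let $B[u;w,v]$ be the linearization of $\delta I[\cdot,v]$ about $u$ in the direction $w$: $$B[u;w,v]=\int_\Omega\big(v\,F_{uu}\,w+v\,F_{u\nabla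 u}\cdot\nabla w+w\,F_{u\nabla u}\cdot\nabla v+\nabla w\cdot F_{\nabla u\nabla u}\nabla v\big)\,dx.$$ Let $u_h\in U_0^h$ be a finite element solution, $\delta I[u_h,v_h]=0$ for all $v_h\in U_0^h$, and let $z_h\in W^h$ be the hierarchical basis error estimate, $\delta I[u_h,w_h]+B[u_h;z_h,w_h]=0$ for all $w_h\in W^h$. Let $r_h=F_u-\nabla\cdot F_{\nabla u}$ (evaluated at $(x,u_h,\nabla u_h)$) be the residual on each element. On a face $\gamma$ shared by two elements $K,K'$ let the edge jump $R_h$ be the sum of the two traces of $F_{\nabla u}(x,u_h,\nabla u_h)\cdot n$ from $K$ and $K'$, with $n$ the respective outward unit normal; put $R_h=0$ on faces in $\partial\Omega$. Define $$E[u_h,z_h]=\sum_{K\in\mathcal T_h}\Big[\|r_h\|_{L^2(K)}\|z_h\|_{L^2(K)}+\tfrac12\sum_{\gamma\in\partial K}\|R_h\|_{L^2(\gamma)}\|z_h\|_{L^2(\gamma)}\Big],$$ $$\eta_K=\langle r_h\rangle_{L^2(K)}+\frac1{|K|}\sum_{\gamma\in\partial K}|\gamma|\,\langle R_h\rangle_{L^2(\gamma)},\qquad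 \langle v\rangle_{L^2(\omega)}=|\omega|^{-1/2}\|v\|_{L^2(\omega)} .$$ Let $H_K=H_K(z_h)$ be the (constant) Hessian of $z_h$ on $K$ and $|H_K|=\sqrt{H_K^2}$. For $\alpha_h>0$ let $H_{K,\alpha}=I+\alpha_h^{-1}|H_K|$ and $$\rho_K=\big(1+\alpha_h^{-1}\eta_K\big)^{\frac d{d+2}}\det(H_{K,\alpha})^{\frac1{d+2}},\qquad M_K=\rho_K^{2/d}\det(H_{K,\alpha})^{-1/d}H_{K,\alpha},\qquad \sigma_h=\sum_{K}\rho_K|K| .$$ **Claim.** For every $\alpha_h>0$: 1. $E[u_h,z_h]\le C\sum_K \eta_K\,|K|\,\mathrm{tr}\big((F_K')^T|H_K|F_K'\big)$. 2. $E[u_h,z_h]\le C\sum_K(\alpha_h+\eta_K)\,|K|\,\mathrm{tr}\big((F_K')^T(\alpha_hI+|H_K|)F_K'\big)$, or equivalently $E[u_h,z_h]\le C\alpha_h^2\sum_K\big(1+\alpha_h^{-1}\eta_K\big)|K|\,\mathrm{tr}\big((F_K')^TH_{K,\alpha}F_K'\big)$. 3. Each $M_K$ is symmetric positive definite with $\sqrt{\det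 M_K}=\rho_K$. 4. If the mesh satisfies the alignment condition $\frac1d\mathrm{tr}\big((F_K')^TM_KF_K'\big)=\det\big((F_K')^TM_KF_K'\big)^{1/d}$ for all $K$, then $E[u_h,z_h]\le C\alpha_h^2\,S$ with $S=\sum_K\big(1+\alpha_h^{-1}\eta_K\big)|K|^{\frac{d+2}d}\det(H_{K,\alpha})^{1/d}$. 5. Always $S\ge\sigma_h^{\frac{d+2}d}N^{-2/d}$, with equality if the mesh satisfies the equidistribution condition $\rho_K|K|=\sigma_h/N$ for all $K$. 6. If the mesh satisfies both the alignment and the equidistribution conditions, then $E[u_h,z_h]\le C\,\alpha_h^2\,\sigma_h^{\frac{d+2}d}\,N^{-\frac2d}$. -/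

import Mathlib

open MeasureTheory
open scoped ContDiff MatrixOrder

noncomputable section

namespace AnisoMesh

/-- The Euclidean space of dimension `d`. -/
abbrev Pt (d : ℕ) : Type := EuclideanSpace ℝ (Fin d)

variable {d : ℕ}

/-! ### Triangulations -/

/-- The closed simplex spanned by a finite set of vertices. -/
def cell (s : Finset (Pt d)) : Set (Pt d) := convexHull ℝ (s : Set (Pt d))

/-- A (conforming, simplicial, finite) triangulation of a domain `Ω`: a simplicial complex all of
whose maximal simplices have dimension `d`, whose underlying space is the closure of `Ω`, and such
that the boundary of `Ω` is a union of simplices of the complex. -/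
structure Triangulation (Ω : Set (Pt d)) extends Geometry.SimplicialComplex ℝ (Pt d) where
  finite_faces : faces.Finite
  pure_dim : ∀ s ∈ faces, ∃ t ∈ faces, s ⊆ t ∧ t.card = d + 1
  space_eq : toSimplicialComplex.space = closure Ω
  boundary_eq : ∀ x ∈ frontier Ω, ∃ s ∈ faces, x ∈ cell s ∧ cell s ⊆ frontier Ω

variable {Ω : Set (Pt d)}

/-- The elements `K` of the mesh: its simplices of dimension `d`, given by their vertex sets. -/
def Triangulation.elements (T : Triangulation Ω) : Finset (Finset (Pt d)) :=
  T.finite_faces.toFinset.filter (fun s => s.card = d + 1)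

/-- The number `N` of elements. -/
def Triangulation.numElements (T : Triangulation Ω) : ℕ := T.elements.card

/-- The faces `γ ∈ ∂K` of an element, i.e. its `(d-1)`-dimensional subsimplices. -/
def facets (K : Finset (Pt d)) : Finset (Finset (Pt d)) := K.powersetCard d

/-- The volume `|K|` of an element. -/
def vol (K : Finset (Pt d)) : ℝ := (volume : Measure (Pt d)).real (cell K)

/-- The `(d-1)`-dimensional surface measure (the counting measure if `d = 1`). -/
def surf (d : ℕ) : Measure (Pt d) := Measure.euclideanHausdorffMeasure (d - 1)

/-- The area `|γ|` of a face. -/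
def area (γ : Finset (Pt d)) : ℝ := (surf d).real (cell γ)

/-- `n` is the unit normal to the face `γ` of `K` that points out of `K`. -/
def IsOutwardNormal (K γ : Finset (Pt d)) (n : Pt d) : Prop :=
  ‖n‖ = 1 ∧ (∀ x ∈ γ, ∀ y ∈ γ, inner ℝ n (y - x) = 0) ∧
    ∀ x ∈ γ, ∀ y ∈ K, y ∉ γ → inner ℝ n (y - x) < 0

/-- The outward unit normal to the face `γ` of `K`. -/
def outwardNormal (K γ : Finset (Pt d)) : Pt d := Classical.epsilon (IsOutwardNormal K γ)

/-! ### Finite element spaces -/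

/-- `v` is affine on the simplex `K`. -/
def IsAffineOn (v : Pt d → ℝ) (K : Finset (Pt d)) : Prop :=
  ∃ g : Pt d →ᵃ[ℝ] ℝ, Set.EqOn v g (cell K)

/-- The linear finite element space `U₀ʰ`: functions that are affine on every (closed) element and
vanish on the boundary of `Ω`. Functions on `Ω` are extended by zero. -/
def linearSpace (T : Triangulation Ω) : Set (Pt d → ℝ) :=
  {v | (∀ K ∈ T.elements, IsAffineOn v K) ∧ ∀ x, x ∉ Ω → v x = 0}

/-- `φ` is the nodal (hat) function of the vertex `a`, extended by zero. -/
def IsHat (T : Triangulation Ω) (a : Pt d) (φ : Pt d → ℝ) : Prop :=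
  (∀ K ∈ T.elements, IsAffineOn φ K) ∧ φ a = 1 ∧
    (∀ b ∈ T.vertices, b ≠ a → φ b = 0) ∧ ∀ x, x ∉ closure Ω → φ x = 0

/-- `w` is the quadratic bubble function of an edge of the mesh which does not lie in `∂Ω`. -/
def IsEdgeBubble (T : Triangulation Ω) (w : Pt d → ℝ) : Prop :=
  ∃ (e : Finset (Pt d)) (a b : Pt d) (φ ψ : Pt d → ℝ), e ∈ T.faces ∧ (e : Set (Pt d)) = {a, b} ∧
    a ≠ b ∧ ¬ cell e ⊆ frontier Ω ∧ IsHat T a φ ∧ IsHat T b ψ ∧ w = fun x => 4 * φ x * ψ x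

/-- The space `Wʰ` spanned by the edge bubble functions. -/
def bubbleSpace (T : Triangulation Ω) : Submodule ℝ (Pt d → ℝ) :=
  Submodule.span ℝ {w | IsEdgeBubble T w}

/-! ### The functional `I[v] = ∫_Ω F(x, v, ∇v) dx`, its first variation and linearization -/

/-- `F_u`. -/
def Fu (F : Pt d → ℝ → Pt d → ℝ) (x : Pt d) (u : ℝ) (p : Pt d) : ℝ :=
  deriv (fun s => F x s p) u

/-- `F_{∇u}`. -/
def Fp (F : Pt d → ℝ → Pt d → ℝ) (x : Pt d) (u : ℝ) (p : Pt d) : Pt d :=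
  gradient (fun q => F x u q) p

/-- `∂²F/∂u²`. -/
def Fuu (F : Pt d → ℝ → Pt d → ℝ) (x : Pt d) (u : ℝ) (p : Pt d) : ℝ :=
  deriv (fun s => Fu F x s p) u

/-- `∂²F/∂u∂∇u`. -/
def Fup (F : Pt d → ℝ → Pt d → ℝ) (x : Pt d) (u : ℝ) (p : Pt d) : Pt d :=
  gradient (fun q => Fu F x u q) p

/-- `∂²F/∂∇u∂∇u`, as a linear map. -/
def Fpp (F : Pt d → ℝ → Pt d → ℝ) (x : Pt d) (u : ℝ) (p : Pt d) : Pt d →L[ℝ] Pt d :=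
  fderiv ℝ (fun q => Fp F x u q) p

/-- The first variation `δI[u, v]`. -/
def firstVariation (Ω : Set (Pt d)) (F : Pt d → ℝ → Pt d → ℝ) (u v : Pt d → ℝ) : ℝ :=
  ∫ x in Ω, (Fu F x (u x) (gradient u x) * v x +
    inner ℝ (Fp F x (u x) (gradient u x)) (gradient v x))

/-- The linearization `B[u; w, v]` of the first variation about `u`. -/
def linearization (Ω : Set (Pt d)) (F : Pt d → ℝ → Pt d → ℝ) (u w v : Pt d → ℝ) : ℝ :=
  ∫ x in Ω, (v x * Fuu F x (u x) (gradient u x) * w x +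
    v x * inner ℝ (Fup F x (u x) (gradient u x)) (gradient w x) +
    w x * inner ℝ (Fup F x (u x) (gradient u x)) (gradient v x) +
    inner ℝ (Fpp F x (u x) (gradient u x) (gradient w x)) (gradient v x))

/-- `uh` is a linear finite element solution: it satisfies the Galerkin equations (as every
minimizer of `I` over `U₀ʰ` does). -/
def IsFESolution (T : Triangulation Ω) (F : Pt d → ℝ → Pt d → ℝ) (uh : Pt d → ℝ) : Prop :=
  uh ∈ linearSpace T ∧ ∀ v ∈ linearSpace T, firstVariation Ω F uh v = 0

/-- `zh` is the hierarchical basis error estimate: the solution in `Wʰ` of the linearized error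
problem. -/
def IsErrorEstimate (T : Triangulation Ω) (F : Pt d → ℝ → Pt d → ℝ) (uh zh : Pt d → ℝ) : Prop :=
  zh ∈ bubbleSpace T ∧
    ∀ w ∈ bubbleSpace T, firstVariation Ω F uh w + linearization Ω F uh zh w = 0

/-! ### Residual, edge jumps and the functional `E` -/

/-- The field `x ↦ F_{∇u}(x, uh, ∇uh)` on the closed element `K`; on `∂K` this is the trace
taken from the inside of `K`. -/
def flux (F : Pt d → ℝ → Pt d → ℝ) (uh : Pt d → ℝ) (K : Finset (Pt d)) (x : Pt d) : Pt d :=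
  Fp F x (uh x) (gradientWithin uh (cell K) x)

/-- The residual `r_h = F_u - ∇ ⬝ F_{∇u}` on the element `K`. -/
def residual (F : Pt d → ℝ → Pt d → ℝ) (uh : Pt d → ℝ) (K : Finset (Pt d)) (x : Pt d) : ℝ :=
  Fu F x (uh x) (gradientWithin uh (cell K) x) -
    ∑ i, fderivWithin ℝ (flux F uh K) (cell K) x (EuclideanSpace.single i 1) i

open Classical in
/-- The edge jump `R_h` on the face `γ`: zero on boundary faces, and otherwise the sum of the
outward normal fluxes from the two elements that share `γ`. -/
def jump (T : Triangulation Ω) (F : Pt d → ℝ → Pt d → ℝ) (uh : Pt d → ℝ)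
    (γ : Finset (Pt d)) (x : Pt d) : ℝ :=
  if cell γ ⊆ frontier Ω then 0
  else ∑ K ∈ T.elements.filter (fun K => γ ⊆ K),
    inner ℝ (flux F uh K x) (outwardNormal K γ)

/-- The norm of `v` in `L²(s, μ)`. -/
def normL2 (μ : Measure (Pt d)) (s : Finset (Pt d)) (v : Pt d → ℝ) : ℝ :=
  Real.sqrt (∫ x in cell s, v x ^ 2 ∂μ)

/-- The scaled norm `|s|^{-1/2} ‖v‖_{L²(s)}`. -/
def scaledNormL2 (μ : Measure (Pt d)) (s : Finset (Pt d)) (v : Pt d → ℝ) : ℝ :=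
  normL2 μ s v / Real.sqrt (μ.real (cell s))

/-- The functional `E[uh, zh]`. -/
def errorFunctional (T : Triangulation Ω) (F : Pt d → ℝ → Pt d → ℝ) (uh zh : Pt d → ℝ) : ℝ :=
  ∑ K ∈ T.elements, (normL2 volume K (residual F uh K) * normL2 volume K zh +
    1 / 2 * ∑ γ ∈ facets K, normL2 (surf d) γ (jump T F uh γ) * normL2 (surf d) γ zh)

/-- Scaled residual plus scaled edge jumps of the element `K`:
`⟨r_h⟩_{L²(K)} + |K|⁻¹ ∑_{γ ∈ ∂K} |γ| ⟨R_h⟩_{L²(γ)}`. -/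
def indicator (T : Triangulation Ω) (F : Pt d → ℝ → Pt d → ℝ) (uh : Pt d → ℝ)
    (K : Finset (Pt d)) : ℝ :=
  scaledNormL2 volume K (residual F uh K) +
    1 / vol K * ∑ γ ∈ facets K, area γ * scaledNormL2 (surf d) γ (jump T F uh γ)

/-! ### Hessians and metric tensors -/

/-- The Hessian `H_K(z)` of `z` on `K`, evaluated at the barycentre of `K`; for `z` piecewise
quadratic it is constant on `K`. -/
def hess (z : Pt d → ℝ) (K : Finset (Pt d)) : Matrix (Fin d) (Fin d) ℝ :=
  Matrix.of fun i j => iteratedFDeriv ℝ 2 z (K.centroid ℝ id)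
    ![EuclideanSpace.single i 1, EuclideanSpace.single j 1]

/-- The absolute value `|A| = √(A²)` of a symmetric matrix. -/
def absMat (A : Matrix (Fin d) (Fin d) ℝ) : Matrix (Fin d) (Fin d) ℝ := CFC.sqrt (A * A)

/-- `H_{K,α}(z) = I + α⁻¹ |H_K(z)|`. -/
def hessReg (α : ℝ) (z : Pt d → ℝ) (K : Finset (Pt d)) : Matrix (Fin d) (Fin d) ℝ :=
  1 + (1 / α) • absMat (hess z K)

/-- The Jacobian matrix of an affine map. -/
def jac (f : Pt d →ᵃ[ℝ] Pt d) : Matrix (Fin d) (Fin d) ℝ :=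
  Matrix.of fun i j => f.linear (EuclideanSpace.single j 1) i

/-- The congruence `(F_K')ᵀ A F_K'`. -/
def pullback (f : Pt d →ᵃ[ℝ] Pt d) (A : Matrix (Fin d) (Fin d) ℝ) : Matrix (Fin d) (Fin d) ℝ :=
  (jac f).transpose * A * jac f

/-- A reference element: a `d`-simplex of volume one. -/
def IsReferenceElement (Khat : Finset (Pt d)) : Prop :=
  Khat.card = d + 1 ∧ AffineIndependent ℝ ((↑) : Khat → Pt d) ∧ vol Khat = 1

/-- `FK K` is, for every element `K`, an affine map of the reference element onto `K`
(carrying vertices to vertices). -/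
def IsElementMap (T : Triangulation Ω) (Khat : Finset (Pt d))
    (FK : Finset (Pt d) → (Pt d →ᵃ[ℝ] Pt d)) : Prop :=
  ∀ K ∈ T.elements, FK K '' (Khat : Set (Pt d)) = (K : Set (Pt d))

/-- The alignment condition for a piecewise constant metric tensor `M`. -/
def IsAligned (T : Triangulation Ω) (FK : Finset (Pt d) → (Pt d →ᵃ[ℝ] Pt d))
    (M : Finset (Pt d) → Matrix (Fin d) (Fin d) ℝ) : Prop :=
  ∀ K ∈ T.elements,
    1 / (d : ℝ) * (pullback (FK K) (M K)).trace = (pullback (FK K) (M K)).det ^ (1 / (d : ℝ))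

/-- `σ_h = ∑_K ρ_K |K|`, where `ρ_K = √(det M_K)`. -/
def sigma (T : Triangulation Ω) (M : Finset (Pt d) → Matrix (Fin d) (Fin d) ℝ) : ℝ :=
  ∑ K ∈ T.elements, Real.sqrt (M K).det * vol K

/-- The equidistribution condition `ρ_K |K| = σ_h / N`, where `ρ_K = √(det M_K)`. -/
def IsEquidistributed (T : Triangulation Ω)
    (M : Finset (Pt d) → Matrix (Fin d) (Fin d) ℝ) : Prop :=
  ∀ K ∈ T.elements, Real.sqrt (M K).det * vol K = sigma T M / T.numElements

/-- The adaptation function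
`ρ_K = (1 + α⁻¹ (scaled residual + scaled jumps))^{d/(d+2)} det(H_{K,α})^{1/(d+2)}`. -/
def rho (T : Triangulation Ω) (F : Pt d → ℝ → Pt d → ℝ) (uh zh : Pt d → ℝ) (α : ℝ)
    (K : Finset (Pt d)) : ℝ :=
  (1 + 1 / α * indicator T F uh K) ^ ((d : ℝ) / (d + 2)) *
    (hessReg α zh K).det ^ (1 / ((d : ℝ) + 2))

/-- The metric tensor `M_K = ρ_K^{2/d} det(H_{K,α})^{-1/d} H_{K,α}`. -/
def metric (T : Triangulation Ω) (F : Pt d → ℝ → Pt d → ℝ) (uh zh : Pt d → ℝ) (α : ℝ)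
    (K : Finset (Pt d)) : Matrix (Fin d) (Fin d) ℝ :=
  (rho T F uh zh α K ^ (2 / (d : ℝ)) * (hessReg α zh K).det ^ (-(1 / (d : ℝ)))) • hessReg α zh K

/-- `∑_K (1 + α⁻¹ (scaled residual + scaled jumps)) |K|^{(d+2)/d} det(H_{K,α})^{1/d}`. -/
def anisoSum (T : Triangulation Ω) (F : Pt d → ℝ → Pt d → ℝ) (uh zh : Pt d → ℝ) (α : ℝ) : ℝ :=
  ∑ K ∈ T.elements, (1 + 1 / α * indicator T F uh K) * vol K ^ (((d : ℝ) + 2) / d) *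
    (hessReg α zh K).det ^ (1 / (d : ℝ))

end AnisoMesh

end

namespace AnisoMesh

variable {d : ℕ}

/-! ### Quadratic forms of matrices -/

/-! The estimate is a sup bound for `zh` on each element followed by a power mean inequality.

On `K` the function `zh` agrees with a quadratic `Q` that vanishes at the vertices. Expanding at `x
∈ K`, the affine Taylor part takes at each vertex `a` the value `-½ B(a - x, a - x)`, so by
convexity its value at `x`, which is `Q x`, obeys the same bound (`IsQuadratic.abs_le_of_vanish`).
Writing `a - x = F_K'(a' - x')` and replacing `H_K` by `|H_K|` gives `|zh| ≤ ½ diam(K̂)² tr(F_K'ᵀ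
|H_K| F_K')` (`abs_le_of_mem_bubbleSpace`). This one bound serves both the volume term and the face
terms, so no trace inequality is needed, and `element_error_le` collects the factors `η_K |K|`.

Alignment is the equality case of the arithmetic-geometric mean inequality: it turns the trace into
`d |K|^{2/d} det(H_{K,α})^{1/d}` (`trace_pullback_of_aligned`). The exponents in `ρ_K` make each
summand of `S` equal to `(ρ_K |K|)^p` with `p = (d+2)/d` (`rho_mul_rpow`). The lower bound on `S` is
then convexity of `t ↦ t^p`, and equidistribution makes all terms equal, which is its equality case.
-/

theorem dotProduct_mulVec_le_trace {A : Matrix (Fin d) (Fin d) ℝ} (hA : A.PosSemidef)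
    (w : Pt d) : w.ofLp ⬝ᵥ A.mulVec w.ofLp ≤ ‖w‖ ^ 2 * A.trace := by
  -- For a rank-one term `v vᵀ`, of trace `|v|²`, the claim is Cauchy–Schwarz.
  obtain ⟨m, v, rfl⟩ := Matrix.posSemidef_iff_eq_sum_vecMulVec.mp hA
  rw [Matrix.sum_mulVec, dotProduct_sum, Matrix.trace_sum, Finset.mul_sum]
  refine Finset.sum_le_sum fun i _ => ?_
  rw [Matrix.vecMulVec_mulVec, Matrix.trace_vecMulVec, EuclideanSpace.real_norm_sq_eq]
  have h := Finset.sum_mul_sq_le_sq_mul_sq Finset.univ w.ofLp (v i)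
  have h1 : w.ofLp ⬝ᵥ v i = ∑ j, w.ofLp j * v i j := rfl
  have h2 : star (v i) ⬝ᵥ w.ofLp = ∑ j, w.ofLp j * v i j := by
    simp [dotProduct, mul_comm]
  have h3 : v i ⬝ᵥ star (v i) = ∑ j, v i j ^ 2 := by
    simp [dotProduct, sq]
  rw [dotProduct_smul, op_smul_eq_smul, smul_eq_mul, h1, h2, h3, ← sq]
  exact h

theorem absMat_posSemidef (A : Matrix (Fin d) (Fin d) ℝ) : (absMat A).PosSemidef :=
  Matrix.LE.le.posSemidef (CFC.sqrt_nonneg _)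

theorem absMat_eq_abs {A : Matrix (Fin d) (Fin d) ℝ} (hA : IsSelfAdjoint A) :
    absMat A = CFC.abs A := by
  rw [absMat, CFC.abs, hA.star_eq]

/-- `|A| + A` and `|A| - A` are twice the positive and negative parts of `A`, hence positive
semidefinite. -/
theorem abs_dotProduct_mulVec_le_absMat {A : Matrix (Fin d) (Fin d) ℝ} (hA : A.IsHermitian)
    (w : Fin d → ℝ) : |w ⬝ᵥ A.mulVec w| ≤ w ⬝ᵥ (absMat A).mulVec w := by
  have hs : IsSelfAdjoint A := hA
  have h1 : (absMat A + A).PosSemidef := by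
    rw [absMat_eq_abs hs, CFC.abs_add_self A hs]
    exact Matrix.LE.le.posSemidef (nsmul_nonneg (CFC.posPart_nonneg A) 2)
  have h2 : (absMat A - A).PosSemidef := by
    rw [absMat_eq_abs hs, CFC.abs_sub_self A hs]
    exact Matrix.LE.le.posSemidef (nsmul_nonneg (CFC.negPart_nonneg A) 2)
  have h3 := h1.dotProduct_mulVec_nonneg w
  have h4 := h2.dotProduct_mulVec_nonneg w
  simp only [Matrix.add_mulVec, Matrix.sub_mulVec, dotProduct_add, dotProduct_sub,
    star_trivial] at h3 h4
  rw [abs_le]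
  constructor <;> linarith

theorem pullback_posSemidef (f : Pt d →ᵃ[ℝ] Pt d) {A : Matrix (Fin d) (Fin d) ℝ}
    (hA : A.PosSemidef) : (pullback f A).PosSemidef := by
  simpa [pullback] using hA.conjTranspose_mul_mul_same (jac f)

theorem jac_eq_toMatrix (f : Pt d →ᵃ[ℝ] Pt d) :
    jac f = LinearMap.toMatrix (EuclideanSpace.basisFun (Fin d) ℝ).toBasis
      (EuclideanSpace.basisFun (Fin d) ℝ).toBasis f.linear := by
  ext i j
  simp [jac, LinearMap.toMatrix_apply]

theorem det_jac (f : Pt d →ᵃ[ℝ] Pt d) : (jac f).det = LinearMap.det f.linear := by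
  rw [jac_eq_toMatrix, LinearMap.det_toMatrix]

theorem jac_mulVec (f : Pt d →ᵃ[ℝ] Pt d) (w : Pt d) :
    (jac f).mulVec w.ofLp = (f.linear w).ofLp := by
  rw [jac_eq_toMatrix]
  have h := LinearMap.toMatrix_mulVec_repr (EuclideanSpace.basisFun (Fin d) ℝ).toBasis
    (EuclideanSpace.basisFun (Fin d) ℝ).toBasis f.linear w
  have hr : ∀ u : Pt d, ⇑((EuclideanSpace.basisFun (Fin d) ℝ).toBasis.repr u) = u.ofLp := by
    intro u
    ext i
    simp
  rwa [hr, hr] at h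

theorem dotProduct_pullback (f : Pt d →ᵃ[ℝ] Pt d) (A : Matrix (Fin d) (Fin d) ℝ) (w : Pt d) :
    w.ofLp ⬝ᵥ (pullback f A).mulVec w.ofLp =
      (f.linear w).ofLp ⬝ᵥ A.mulVec (f.linear w).ofLp := by
  rw [← jac_mulVec, pullback, ← Matrix.mulVec_mulVec, ← Matrix.mulVec_mulVec,
    Matrix.dotProduct_mulVec _ (jac f).transpose, Matrix.vecMul_transpose]

/-- The quadratic form of a symmetric matrix on an element is controlled by the trace of the
pulled back absolute value. -/
theorem abs_dotProduct_mulVec_linear_le (f : Pt d →ᵃ[ℝ] Pt d) {A : Matrix (Fin d) (Fin d) ℝ}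
    (hA : A.IsHermitian) (w : Pt d) :
    |(f.linear w).ofLp ⬝ᵥ A.mulVec (f.linear w).ofLp| ≤
      ‖w‖ ^ 2 * (pullback f (absMat A)).trace := by
  refine (abs_dotProduct_mulVec_le_absMat hA _).trans ?_
  rw [← dotProduct_pullback]
  exact dotProduct_mulVec_le_trace (pullback_posSemidef f (absMat_posSemidef A)) w

/-! ### Quadratic functions -/

/-- `Q` is a quadratic function with Hessian `B`. -/
def IsQuadratic (Q : Pt d → ℝ) (B : Pt d →L[ℝ] Pt d →L[ℝ] ℝ) : Prop :=
  (∀ x y, B x y = B y x) ∧ ∃ (c : ℝ) (l : Pt d →L[ℝ] ℝ), ∀ x, Q x = c + l x + 1 / 2 * B x x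

theorem isQuadratic_zero : IsQuadratic (fun _ : Pt d => 0) 0 :=
  ⟨fun _ _ => rfl, 0, 0, fun _ => by simp⟩

theorem IsQuadratic.add {Q R : Pt d → ℝ} {B D : Pt d →L[ℝ] Pt d →L[ℝ] ℝ}
    (hQ : IsQuadratic Q B) (hR : IsQuadratic R D) :
    IsQuadratic (fun x => Q x + R x) (B + D) := by
  obtain ⟨hB, c, l, h⟩ := hQ
  obtain ⟨hD, c', l', h'⟩ := hR
  refine ⟨fun x y => by simp [hB x y, hD x y], c + c', l + l', fun x => ?_⟩
  simp only [h, h', _root_.add_apply]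
  ring

theorem IsQuadratic.smul {Q : Pt d → ℝ} {B : Pt d →L[ℝ] Pt d →L[ℝ] ℝ}
    (hQ : IsQuadratic Q B) (r : ℝ) : IsQuadratic (fun x => r * Q x) (r • B) := by
  obtain ⟨hB, c, l, h⟩ := hQ
  refine ⟨fun x y => by simp [hB x y], r * c, r • l, fun x => ?_⟩
  simp only [h, _root_.smul_apply, smul_eq_mul]
  ring

theorem affineMap_eq_add_linear (f : Pt d →ᵃ[ℝ] ℝ) (x : Pt d) :
    f x = f 0 + LinearMap.toContinuousLinearMap f.linear x := by
  have := f.map_vadd 0 x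
  simp only [vadd_eq_add, add_zero] at this
  rw [this, LinearMap.coe_toContinuousLinearMap', add_comm]

/-- On an element an edge bubble is a multiple of such a product. The Hessian is the symmetrized
tensor product of the two linear parts. -/
theorem isQuadratic_mul (f g : Pt d →ᵃ[ℝ] ℝ) : ∃ B, IsQuadratic (fun x => f x * g x) B := by
  set l := LinearMap.toContinuousLinearMap f.linear
  set m := LinearMap.toContinuousLinearMap g.linear
  refine ⟨l.smulRight m + m.smulRight l, fun x y => ?_, f 0 * g 0, f 0 • m + g 0 • l,
    fun x => ?_⟩
  · simp; ring
  · simp only [affineMap_eq_add_linear f x, affineMap_eq_add_linear g x,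
      _root_.add_apply, _root_.smul_apply,
      ContinuousLinearMap.smulRight_apply, smul_eq_mul]
    ring

theorem IsQuadratic.hasFDerivAt {Q : Pt d → ℝ} {B : Pt d →L[ℝ] Pt d →L[ℝ] ℝ}
    (hQ : IsQuadratic Q B) : ∃ l : Pt d →L[ℝ] ℝ, ∀ x, HasFDerivAt Q (l + B x) x := by
  obtain ⟨hB, c, l, h⟩ := hQ
  refine ⟨l, fun x => ?_⟩
  have h1 : HasFDerivAt (fun y => B y y) (B x + B.flip x) x := by
    exact ((B.hasFDerivAt (x := x)).clm_apply (hasFDerivAt_id x)).congr_fderiv (by ext y; simp)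
  have h2 := (l.hasFDerivAt (x := x)).const_add c |>.add (h1.const_mul (1 / 2))
  rw [show Q = fun y => c + l y + 1 / 2 * B y y from funext h]
  refine h2.congr_fderiv ?_
  ext y
  simp [hB y x]
  ring

theorem IsQuadratic.iteratedFDeriv_two {Q : Pt d → ℝ} {B : Pt d →L[ℝ] Pt d →L[ℝ] ℝ}
    (hQ : IsQuadratic Q B) (x u v : Pt d) : iteratedFDeriv ℝ 2 Q x ![u, v] = B u v := by
  obtain ⟨l, hl⟩ := hQ.hasFDerivAt
  rw [iteratedFDeriv_two_apply, show fderiv ℝ Q = fun x => l + B x from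
    funext fun x => (hl x).fderiv, ((B.hasFDerivAt (x := x)).const_add l).fderiv]
  rfl

/-- A quadratic function that vanishes at the vertices of a simplex is bounded there by its second
differences along the segments to the vertices. -/
theorem IsQuadratic.abs_le_of_vanish {Q : Pt d → ℝ} {B : Pt d →L[ℝ] Pt d →L[ℝ] ℝ}
    (hQ : IsQuadratic Q B) {K : Finset (Pt d)} (hK : ∀ a ∈ K, Q a = 0) {x : Pt d}
    (hx : x ∈ cell K) {M : ℝ} (hM : ∀ a ∈ K, |B (a - x) (a - x)| ≤ M) : |Q x| ≤ 1 / 2 * M := by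
  obtain ⟨hB, c, l, h⟩ := hQ
  -- Taylor expansion at `x`, exact for a quadratic; symmetry of `B` makes `l + B x` the derivative
  -- there.
  have key : ∀ a, Q a = Q x + (l + B x) (a - x) + 1 / 2 * B (a - x) (a - x) := by
    intro a
    simp only [h, _root_.add_apply, map_sub, _root_.sub_apply, hB a x]
    ring
  -- The set on the right is convex, since the function inside the absolute value is affine in `y`.
  -- So it suffices to check the vertices, and `y = x` gives the claim.
  have hsub : cell K ⊆ {y | |Q x + (l + B x) (y - x)| ≤ 1 / 2 * M} := by
    refine convexHull_min (fun a ha => ?_) ?_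
    · have h1 := key a
      rw [hK a ha] at h1
      have h2 := hM a ha
      rw [Set.mem_ofPred_eq,
        show Q x + (l + B x) (a - x) = -(1 / 2 * B (a - x) (a - x)) by linarith, abs_neg, abs_mul,
        abs_of_pos (by norm_num : (0 : ℝ) < 1 / 2)]
      linarith
    · intro y hy z hz s t hs ht hst
      have e : Q x + (l + B x) (s • y + t • z - x) =
          s * (Q x + (l + B x) (y - x)) + t * (Q x + (l + B x) (z - x)) := by
        obtain rfl : t = 1 - s := by linarith
        simp only [map_sub, map_add, map_smul, smul_eq_mul]
        ring
      simp only [Set.mem_ofPred_eq, abs_le] at hy hz ⊢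
      rw [e]
      constructor <;> nlinarith
  simpa using hsub hx

theorem bilin_eq_dotProduct (B : Pt d →L[ℝ] Pt d →L[ℝ] ℝ) (v : Pt d) :
    B v v = v.ofLp ⬝ᵥ (Matrix.of fun i j => B (EuclideanSpace.single i 1)
      (EuclideanSpace.single j 1)).mulVec v.ofLp := by
  have hv : v = ∑ i, v i • EuclideanSpace.single i (1 : ℝ) := by
    simpa using ((EuclideanSpace.basisFun (Fin d) ℝ).sum_repr v).symm
  conv_lhs => rw [hv]
  simp only [map_sum, map_smul, _root_.sum_apply, _root_.smul_apply,
    smul_eq_mul, dotProduct, Matrix.mulVec, Matrix.of_apply, Finset.mul_sum]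
  rw [Finset.sum_comm]
  exact Finset.sum_congr rfl fun i _ => Finset.sum_congr rfl fun j _ => by ring

variable {Ω : Set (Pt d)}

/-! ### Geometry of the elements -/

theorem Triangulation.mem_elements {T : Triangulation Ω} {K : Finset (Pt d)} :
    K ∈ T.elements ↔ K ∈ T.faces ∧ K.card = d + 1 := by
  simp [Triangulation.elements]

theorem Triangulation.affineIndependent {T : Triangulation Ω} {K : Finset (Pt d)}
    (hK : K ∈ T.elements) : AffineIndependent ℝ ((↑) : K → Pt d) :=
  T.indep (Triangulation.mem_elements.1 hK).1

theorem Triangulation.mem_vertices_of_mem {T : Triangulation Ω} {K : Finset (Pt d)}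
    (hK : K ∈ T.elements) {a : Pt d} (ha : a ∈ K) : a ∈ T.vertices :=
  Geometry.SimplicialComplex.mem_vertices.2 <|
    T.down_closed (Triangulation.mem_elements.1 hK).1 (Finset.singleton_subset_iff.2 ha)
      (Finset.singleton_nonempty a)

theorem cell_mono {s t : Finset (Pt d)} (h : s ⊆ t) : cell s ⊆ cell t :=
  convexHull_mono (by exact_mod_cast h)

theorem mem_cell {s : Finset (Pt d)} {a : Pt d} (h : a ∈ s) : a ∈ cell s :=
  subset_convexHull ℝ _ h

theorem isCompact_cell (s : Finset (Pt d)) : IsCompact (cell s) :=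
  s.finite_toSet.isCompact_convexHull ℝ

/-- `hess` is evaluated at the barycentre; interiority lets it see only the quadratic representing
`z` on `K`. It also yields positive volume. -/
theorem centroid_mem_interior_cell {K : Finset (Pt d)} (hK : K.card = d + 1)
    (hi : AffineIndependent ℝ ((↑) : K → Pt d)) :
    K.centroid ℝ id ∈ interior (cell K) := by
  have hspan : affineSpan ℝ (Set.range ((↑) : K → Pt d)) = ⊤ := by
    rw [hi.affineSpan_eq_top_iff_card_eq_finrank_add_one]
    simp [hK]
  have h := AffineBasis.centroid_mem_interior_convexHull
    (⟨((↑) : K → Pt d), hi, hspan⟩ : AffineBasis K ℝ (Pt d))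
  change Finset.centroid ℝ Finset.univ ((↑) : K → Pt d) ∈
    interior ((convexHull ℝ) (Set.range ((↑) : K → Pt d))) at h
  rwa [Finset.centroid_univ, Subtype.range_coe] at h

theorem vol_pos {K : Finset (Pt d)} (hK : K.card = d + 1)
    (hi : AffineIndependent ℝ ((↑) : K → Pt d)) : 0 < vol K :=
  ENNReal.toReal_pos
    (Measure.measure_pos_of_nonempty_interior _ ⟨_, centroid_mem_interior_cell hK hi⟩).ne'
    (isCompact_cell K).measure_lt_top.ne

theorem cell_image (f : Pt d →ᵃ[ℝ] Pt d) {s t : Finset (Pt d)}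
    (h : f '' (s : Set (Pt d)) = (t : Set (Pt d))) : f '' cell s = cell t := by
  rw [cell, f.image_convexHull, h, cell]

theorem vol_image (f : Pt d →ᵃ[ℝ] Pt d) {s t : Finset (Pt d)}
    (h : f '' (s : Set (Pt d)) = (t : Set (Pt d))) : vol t = |(jac f).det| * vol s := by
  have e : cell t = (fun y => f 0 + y) '' (f.linear '' cell s) := by
    rw [← cell_image f h, Set.image_image]
    refine Set.image_congr fun x _ => ?_
    simpa [add_comm] using f.map_vadd 0 x
  rw [vol, vol, measureReal_def, measureReal_def, e, Set.image_add_left, measure_preimage_add,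
    Measure.addHaar_image_linearMap, ENNReal.toReal_mul, ENNReal.toReal_ofReal (abs_nonneg _),
    det_jac]

/-- A face of an element has finite area. -/
theorem surf_cell_lt_top {K γ : Finset (Pt d)} (hd : 1 ≤ d)
    (hi : AffineIndependent ℝ ((↑) : K → Pt d)) (hγ : γ ∈ facets K) : surf d (cell γ) < ⊤ := by
  obtain ⟨hsub, hcard⟩ := Finset.mem_powersetCard.1 hγ
  have hiγ : AffineIndependent ℝ ((↑) : γ → Pt d) :=
    AffineIndependent.mono (s := (γ : Set (Pt d))) (t := (K : Set (Pt d))) hi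
      (by exact_mod_cast hsub)
  obtain ⟨p, hp⟩ := Finset.card_pos.1 (by omega : 0 < γ.card)
  set V := vectorSpan ℝ (γ : Set (Pt d))
  have hrank : Module.finrank ℝ V = d - 1 := by
    have he : Set.range ((↑) : γ → Pt d) = (γ : Set (Pt d)) := Subtype.range_coe
    exact (congrArg (fun t => Module.finrank ℝ (vectorSpan ℝ t)) he).symm.trans
      (hiγ.finrank_vectorSpan (by simp [hcard]; omega))
  -- The face is an isometric copy of a bounded subset of its direction space `V`. As `V` has
  -- dimension `d - 1`, the Hausdorff measure of that dimension is finite on bounded sets of `V`.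
  have hiso : Isometry (fun v : V => (v : Pt d) + p) :=
    (isometry_add_right p).comp isometry_subtype_coe
  set s : Set V := (fun v : V => (v : Pt d) + p) ⁻¹' cell γ
  have hs : cell γ = (fun v : V => (v : Pt d) + p) '' s := by
    rw [Set.image_preimage_eq_inter_range, Set.left_eq_inter]
    intro x hx
    refine ⟨⟨x - p, ?_⟩, by simp⟩
    exact vsub_mem_vectorSpan_of_mem_affineSpan_of_mem_affineSpan
      (convexHull_subset_affineSpan _ hx) (subset_affineSpan ℝ _ hp)
  rw [surf, hs, hiso.euclideanHausdorffMeasure_image, ← hrank]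
  refine Bornology.IsBounded.measure_lt_top ?_
  obtain ⟨R, hR⟩ := Metric.isBounded_iff.1 (isCompact_cell γ).isBounded
  refine Metric.isBounded_iff.2 ⟨R, fun x hx y hy => ?_⟩
  rw [← hiso.dist_eq]
  exact hR hx hy

/-! ### Bounds by scaled norms -/

theorem normL2_nonneg (μ : Measure (Pt d)) (s : Finset (Pt d)) (v : Pt d → ℝ) :
    0 ≤ normL2 μ s v := Real.sqrt_nonneg _

theorem scaledNormL2_nonneg (μ : Measure (Pt d)) (s : Finset (Pt d)) (v : Pt d → ℝ) :
    0 ≤ scaledNormL2 μ s v := div_nonneg (normL2_nonneg _ _ _) (Real.sqrt_nonneg _)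

/-- Combines `‖v‖ ≤ m |s|^{1/2}` with `|s|^{1/2} ‖r‖ = |s| ⟨r⟩`. -/
theorem normL2_mul_normL2_le {μ : Measure (Pt d)} {s : Finset (Pt d)} (hs : μ (cell s) < ⊤)
    (r : Pt d → ℝ) {v : Pt d → ℝ} {m : ℝ} (hm : 0 ≤ m) (hv : ∀ x ∈ cell s, |v x| ≤ m) :
    normL2 μ s r * normL2 μ s v ≤ μ.real (cell s) * scaledNormL2 μ s r * m := by
  have h1 : normL2 μ s v ≤ m * √(μ.real (cell s)) := by
    refine Real.sqrt_le_iff.2 ⟨by positivity, ?_⟩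
    rw [mul_pow, Real.sq_sqrt measureReal_nonneg]
    rw [← Real.norm_of_nonneg (integral_nonneg fun x => sq_nonneg (v x))]
    refine (norm_setIntegral_le_of_norm_le_const (C := m ^ 2) hs fun x hx => ?_).trans_eq rfl
    rw [norm_pow, Real.norm_eq_abs]
    exact pow_le_pow_left₀ (abs_nonneg _) (hv x hx) 2
  have h2 : μ.real (cell s) * scaledNormL2 μ s r = √(μ.real (cell s)) * normL2 μ s r := by
    -- For measure zero both sides vanish; otherwise one may divide by the square root.
    rcases (measureReal_nonneg (μ := μ) (s := cell s)).eq_or_lt with h | h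
    · simp [← h]
    · have h3 := Real.sqrt_pos.2 h
      nth_rewrite 1 [← Real.mul_self_sqrt h.le]
      rw [scaledNormL2]
      field_simp
  rw [h2]
  calc normL2 μ s r * normL2 μ s v ≤ normL2 μ s r * (m * √(μ.real (cell s))) :=
        mul_le_mul_of_nonneg_left h1 (normL2_nonneg _ _ _)
    _ = √(μ.real (cell s)) * normL2 μ s r * m := by ring

theorem indicator_nonneg (T : Triangulation Ω) (F : Pt d → ℝ → Pt d → ℝ) (uh : Pt d → ℝ)
    (K : Finset (Pt d)) : 0 ≤ indicator T F uh K :=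
  add_nonneg (scaledNormL2_nonneg _ _ _) <| mul_nonneg
    (one_div_nonneg.2 measureReal_nonneg) <| Finset.sum_nonneg fun _ _ =>
      mul_nonneg measureReal_nonneg (scaledNormL2_nonneg _ _ _)

/-- The contribution of an element to the error functional is bounded by its indicator. -/
theorem element_error_le (hd : 1 ≤ d) {T : Triangulation Ω} (F : Pt d → ℝ → Pt d → ℝ)
    (uh : Pt d → ℝ) {zh : Pt d → ℝ} {K : Finset (Pt d)} (hK : K ∈ T.elements) {m : ℝ}
    (hm : 0 ≤ m) (hz : ∀ x ∈ cell K, |zh x| ≤ m) :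
    normL2 volume K (residual F uh K) * normL2 volume K zh +
      1 / 2 * ∑ γ ∈ facets K, normL2 (surf d) γ (jump T F uh γ) * normL2 (surf d) γ zh ≤
      indicator T F uh K * (vol K * m) := by
  have hi := Triangulation.affineIndependent hK
  have hV := vol_pos (Triangulation.mem_elements.1 hK).2 hi
  have h1 := normL2_mul_normL2_le (μ := volume) (isCompact_cell K).measure_lt_top (residual F uh K) hm hz
  have h2 : ∑ γ ∈ facets K, normL2 (surf d) γ (jump T F uh γ) * normL2 (surf d) γ zh ≤
      ∑ γ ∈ facets K, area γ * scaledNormL2 (surf d) γ (jump T F uh γ) * m :=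
    Finset.sum_le_sum fun γ hγ => normL2_mul_normL2_le (surf_cell_lt_top hd hi hγ) _ hm
      fun x hx => hz x (cell_mono (Finset.mem_powersetCard.1 hγ).1 hx)
  -- Nonnegativity of the face sum allows its factor `1/2` to be dropped.
  have h3 : 0 ≤ ∑ γ ∈ facets K, normL2 (surf d) γ (jump T F uh γ) * normL2 (surf d) γ zh :=
    Finset.sum_nonneg fun _ _ => mul_nonneg (normL2_nonneg _ _ _) (normL2_nonneg _ _ _)
  rw [← Finset.sum_mul] at h2
  have h4 : indicator T F uh K * (vol K * m) =
      vol K * scaledNormL2 volume K (residual F uh K) * m +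
        (∑ γ ∈ facets K, area γ * scaledNormL2 (surf d) γ (jump T F uh γ)) * m := by
    rw [indicator]
    field_simp
  rw [h4]
  have h5 : vol K = (volume : Measure (Pt d)).real (cell K) := rfl
  rw [h5]
  linarith

/-! ### Functions of the bubble space -/

/-- Both properties are linear in `z`, so they need checking only on edge bubbles. The two endpoints
of an edge are distinct, so at every vertex at least one of the two hat functions is zero. -/
theorem exists_isQuadratic_of_mem_bubbleSpace {T : Triangulation Ω} {z : Pt d → ℝ}
    (hz : z ∈ bubbleSpace T) {K : Finset (Pt d)} (hK : K ∈ T.elements) :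
    (∃ Q B, IsQuadratic Q B ∧ Set.EqOn z Q (cell K)) ∧ ∀ a ∈ K, z a = 0 := by
  refine Submodule.span_induction (p := fun z _ =>
    (∃ Q B, IsQuadratic Q B ∧ Set.EqOn z Q (cell K)) ∧ ∀ a ∈ K, z a = 0) ?_ ?_ ?_ ?_ hz
  · rintro w ⟨e, a, b, φ, ψ, -, -, hab, -, hφ, hψ, rfl⟩
    constructor
    · obtain ⟨f, hf⟩ := hφ.1 K hK
      obtain ⟨g, hg⟩ := hψ.1 K hK
      obtain ⟨B, hB⟩ := isQuadratic_mul f g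
      exact ⟨_, _, hB.smul 4, fun x hx => by simp only [hf hx, hg hx, mul_assoc]⟩
    · intro c hc
      have hv := Triangulation.mem_vertices_of_mem hK hc
      by_cases hca : c = a
      · simp [hψ.2.2.1 c hv (hca ▸ hab)]
      · simp [hφ.2.2.1 c hv hca]
  · exact ⟨⟨_, _, isQuadratic_zero, fun _ _ => rfl⟩, fun _ _ => rfl⟩
  · rintro v w - - ⟨⟨Q, B, hQ, hv⟩, hv0⟩ ⟨⟨R, D, hR, hw⟩, hw0⟩
    exact ⟨⟨_, _, hQ.add hR, fun x hx => by simp [hv hx, hw hx]⟩,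
      fun a ha => by simp [hv0 a ha, hw0 a ha]⟩
  · rintro r v - ⟨⟨Q, B, hQ, hv⟩, hv0⟩
    exact ⟨⟨_, _, hQ.smul r, fun x hx => by simp [hv hx]⟩, fun a ha => by simp [hv0 a ha]⟩

theorem hess_eq_of_eqOn {z Q : Pt d → ℝ} {B : Pt d →L[ℝ] Pt d →L[ℝ] ℝ} (hQ : IsQuadratic Q B)
    {K : Finset (Pt d)} (hK : K.card = d + 1) (hi : AffineIndependent ℝ ((↑) : K → Pt d))
    (hz : Set.EqOn z Q (cell K)) :
    hess z K = Matrix.of fun i j => B (EuclideanSpace.single i 1) (EuclideanSpace.single j 1) := by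
  have h : z =ᶠ[nhds (K.centroid ℝ id)] Q :=
    Filter.eventually_of_mem (mem_interior_iff_mem_nhds.1 (centroid_mem_interior_cell hK hi)) hz
  ext i j
  rw [hess, Matrix.of_apply, Matrix.of_apply, (h.iteratedFDeriv ℝ 2).self_of_nhds,
    hQ.iteratedFDeriv_two]

/-- The interpolation estimate for functions of the bubble space. -/
theorem abs_le_of_mem_bubbleSpace {T : Triangulation Ω} {z : Pt d → ℝ} (hz : z ∈ bubbleSpace T)
    {K Khat : Finset (Pt d)} (hK : K ∈ T.elements) {f : Pt d →ᵃ[ℝ] Pt d}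
    (hf : f '' (Khat : Set (Pt d)) = (K : Set (Pt d))) {x : Pt d} (hx : x ∈ cell K) :
    |z x| ≤ 1 / 2 * (Metric.diam (cell Khat) ^ 2 *
      (pullback f (absMat (hess z K))).trace) := by
  obtain ⟨⟨Q, B, hQ, hzQ⟩, hz0⟩ := exists_isQuadratic_of_mem_bubbleSpace hz hK
  have hH := hess_eq_of_eqOn hQ (Triangulation.mem_elements.1 hK).2
    (Triangulation.affineIndependent hK) hzQ
  have hherm : (hess z K).IsHermitian := by
    rw [hH]
    ext i j
    simp [hQ.1 (EuclideanSpace.single i 1)]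
  rw [hzQ hx]
  refine hQ.abs_le_of_vanish (fun a ha => by rw [← hzQ (mem_cell ha), hz0 a ha]) hx
    fun a ha => ?_
  -- Pulling both points back to the reference element leaves a difference `a' - x'` of length at
  -- most `diam K̂`; all dependence on `K` moves into the congruence by `F_K'`.
  obtain ⟨x', hx', rfl⟩ : x ∈ f '' cell Khat := by rwa [cell_image f hf]
  obtain ⟨a', ha', rfl⟩ : a ∈ f '' (Khat : Set (Pt d)) := by rw [hf]; exact ha
  have hlin : f a' - f x' = f.linear (a' - x') := by
    simpa using (f.linearMap_vsub a' x').symm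
  rw [bilin_eq_dotProduct, ← hH, hlin]
  refine (abs_dotProduct_mulVec_linear_le f hherm _).trans ?_
  refine mul_le_mul_of_nonneg_right ?_ (pullback_posSemidef f (absMat_posSemidef _)).trace_nonneg
  refine pow_le_pow_left₀ (norm_nonneg _) ?_ 2
  rw [← dist_eq_norm]
  exact Metric.dist_le_diam_of_mem (isCompact_cell Khat).isBounded (mem_cell ha') hx'

/-! ### The metric tensor -/

theorem hessReg_posDef {α : ℝ} (hα : 0 < α) (z : Pt d → ℝ) (K : Finset (Pt d)) :
    (hessReg α z K).PosDef :=
  Matrix.PosDef.one.add_posSemidef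
    ((absMat_posSemidef _).smul (one_div_nonneg.2 hα.le))

/-- The `d`-th power of the scalar is `r² / det H`, so the scaled matrix has determinant `r²`. -/
theorem posDef_smul_and_sqrt_det (hd : 1 ≤ d) {H : Matrix (Fin d) (Fin d) ℝ} (hH : H.PosDef)
    {r : ℝ} (hr : 0 < r) :
    ((r ^ (2 / (d : ℝ)) * H.det ^ (-(1 / (d : ℝ)))) • H).PosDef ∧
      √((r ^ (2 / (d : ℝ)) * H.det ^ (-(1 / (d : ℝ)))) • H).det = r := by
  have hD := hH.det_pos
  have hd0 : (d : ℝ) ≠ 0 := by positivity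
  refine ⟨hH.smul (by positivity), ?_⟩
  rw [Matrix.det_smul, Fintype.card_fin, mul_pow, ← Real.rpow_mul_natCast hr.le,
    ← Real.rpow_mul_natCast hD.le, div_mul_cancel₀ _ hd0, neg_mul, div_mul_cancel₀ _ hd0,
    Real.rpow_neg_one, mul_assoc, inv_mul_cancel₀ hD.ne', mul_one, Real.rpow_two,
    Real.sqrt_sq hr.le]

theorem trace_pullback_add (f : Pt d →ᵃ[ℝ] Pt d) (A B : Matrix (Fin d) (Fin d) ℝ) :
    (pullback f (A + B)).trace = (pullback f A).trace + (pullback f B).trace := by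
  rw [pullback, Matrix.mul_add, Matrix.add_mul, Matrix.trace_add, pullback, pullback]

theorem pullback_smul (f : Pt d →ᵃ[ℝ] Pt d) (c : ℝ) (A : Matrix (Fin d) (Fin d) ℝ) :
    pullback f (c • A) = c • pullback f A := by
  simp [pullback]

/-- Alignment with a metric tensor determines the trace of the pulled back matrix. -/
theorem trace_pullback_of_aligned (hd : 1 ≤ d) (f : Pt d →ᵃ[ℝ] Pt d)
    {H : Matrix (Fin d) (Fin d) ℝ} (hH : H.PosDef) {c : ℝ} (hc : 0 < c)
    (h : 1 / (d : ℝ) * (pullback f (c • H)).trace = (pullback f (c • H)).det ^ (1 / (d : ℝ))) :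
    (pullback f H).trace = d * (|(jac f).det| ^ (2 / (d : ℝ)) * H.det ^ (1 / (d : ℝ))) := by
  have hD := hH.det_pos
  have hd0 : (d : ℝ) ≠ 0 := by positivity
  have hdet : (pullback f H).det = |(jac f).det| ^ 2 * H.det := by
    rw [pullback, Matrix.det_mul, Matrix.det_mul, Matrix.det_transpose, sq_abs]
    ring
  -- Both sides of the alignment condition are homogeneous of degree one in the matrix, so the
  -- scalar `c` cancels and only the shape of `H` matters.
  rw [pullback_smul, Matrix.trace_smul, Matrix.det_smul, Fintype.card_fin, hdet,
    Real.mul_rpow (by positivity) (by positivity), Real.mul_rpow (by positivity) hD.le,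
    ← Real.rpow_natCast_mul hc.le, mul_one_div_cancel hd0, Real.rpow_one,
    ← Real.rpow_natCast_mul (abs_nonneg _), smul_eq_mul] at h
  push_cast at h
  rw [mul_one_div] at h
  have h1 : c * (pullback f H).trace =
      c * (d * (|(jac f).det| ^ (2 / (d : ℝ)) * H.det ^ (1 / (d : ℝ)))) := by
    field_simp at h ⊢
    linarith
  exact mul_left_cancel₀ hc.ne' h1

/-! ### Power means and equidistribution -/

/-- This identity fixes the exponents in `rho`: it presents `anisoSum` as a sum of `p`-th powers of
the terms of `sigma`. -/
theorem rho_mul_rpow (hd : 1 ≤ d) {a D V : ℝ} (ha : 0 ≤ a) (hD : 0 ≤ D) (hV : 0 ≤ V) :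
    (a ^ ((d : ℝ) / (d + 2)) * D ^ (1 / ((d : ℝ) + 2)) * V) ^ (((d : ℝ) + 2) / d) =
      a * V ^ (((d : ℝ) + 2) / d) * D ^ (1 / (d : ℝ)) := by
  have hd0 : (d : ℝ) ≠ 0 := by positivity
  have hd2 : (d : ℝ) + 2 ≠ 0 := by positivity
  rw [Real.mul_rpow (by positivity) hV, Real.mul_rpow (by positivity) (by positivity),
    ← Real.rpow_mul ha, ← Real.rpow_mul hD,
    show (d : ℝ) / (d + 2) * ((d + 2) / d) = 1 by field_simp,
    show 1 / ((d : ℝ) + 2) * ((d + 2) / d) = 1 / d by field_simp, Real.rpow_one]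
  ring

/-- Jensen's inequality for the convex function `t ↦ t^p`. The empty sum is consistent because `0 ^
p = 0` for `p ≠ 0`. -/
theorem rpow_sum_mul_card_rpow_le_sum_rpow {ι : Type*} (s : Finset ι) {f : ι → ℝ} {p : ℝ}
    (hp : 1 ≤ p) (hf : ∀ i ∈ s, 0 ≤ f i) :
    (∑ i ∈ s, f i) ^ p * (s.card : ℝ) ^ (-(p - 1)) ≤ ∑ i ∈ s, f i ^ p := by
  rcases s.eq_empty_or_nonempty with rfl | hs
  · simp [Real.zero_rpow (by linarith : p ≠ 0)]
  have hN : (0 : ℝ) < s.card := by exact_mod_cast hs.card_pos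
  rw [Real.rpow_neg hN.le, ← div_eq_mul_inv, div_le_iff₀ (by positivity), mul_comm]
  exact Real.rpow_sum_le_const_mul_sum_rpow_of_nonneg s hp hf

theorem sum_rpow_eq_of_forall_eq_average {ι : Type*} (s : Finset ι) {f : ι → ℝ} {p : ℝ}
    (hp : 1 ≤ p) (hf : ∀ i ∈ s, 0 ≤ f i) (h : ∀ i ∈ s, f i = (∑ j ∈ s, f j) / s.card) :
    ∑ i ∈ s, f i ^ p = (∑ i ∈ s, f i) ^ p * (s.card : ℝ) ^ (-(p - 1)) := by
  rcases s.eq_empty_or_nonempty with rfl | hs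
  · simp [Real.zero_rpow (by linarith : p ≠ 0)]
  have hN : (0 : ℝ) < s.card := by exact_mod_cast hs.card_pos
  rw [Finset.sum_congr rfl fun i hi => by rw [h i hi], Finset.sum_const, nsmul_eq_mul,
    Real.div_rpow (Finset.sum_nonneg hf) hN.le, neg_sub, Real.rpow_sub hN, Real.rpow_one]
  field_simp

end AnisoMesh

/-! ### The main theorem -/

open AnisoMesh

theorem mainTheorem1 (d : ℕ) (hd : 1 ≤ d) (Khat : Finset (AnisoMesh.Pt d))
    (hKhat : AnisoMesh.IsReferenceElement Khat) :
    ∃ C : ℝ, 0 < C ∧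
      ∀ (Ω : Set (AnisoMesh.Pt d)) (_ : IsOpen Ω) (_ : Ω.Nonempty)
        (T : AnisoMesh.Triangulation Ω)
        (FK : Finset (AnisoMesh.Pt d) → (AnisoMesh.Pt d →ᵃ[ℝ] AnisoMesh.Pt d))
        (_ : AnisoMesh.IsElementMap T Khat FK)
        (F : AnisoMesh.Pt d → ℝ → AnisoMesh.Pt d → ℝ)
        (_ : ContDiffOn ℝ ∞ (fun q : AnisoMesh.Pt d × ℝ × AnisoMesh.Pt d => F q.1 q.2.1 q.2.2)
          (closure Ω ×ˢ Set.univ))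
        (uh zh : AnisoMesh.Pt d → ℝ)
        (_ : AnisoMesh.IsFESolution T F uh) (_ : AnisoMesh.IsErrorEstimate T F uh zh)
        (α : ℝ) (_ : 0 < α),
        -- the bound by residual, edge jumps and the Hessian of the error estimate
        AnisoMesh.errorFunctional T F uh zh ≤
          C * ∑ K ∈ T.elements, AnisoMesh.indicator T F uh K *
            (AnisoMesh.vol K *
              (AnisoMesh.pullback (FK K) (AnisoMesh.absMat (AnisoMesh.hess zh K))).trace) ∧
        -- the regularized bound, in its two forms
        AnisoMesh.errorFunctional T F uh zh ≤
          C * ∑ K ∈ T.elements, (α + AnisoMesh.indicator T F uh K) *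
            (AnisoMesh.vol K * (AnisoMesh.pullback (FK K)
              (α • (1 : Matrix (Fin d) (Fin d) ℝ) +
                AnisoMesh.absMat (AnisoMesh.hess zh K))).trace) ∧
        AnisoMesh.errorFunctional T F uh zh ≤
          C * α ^ 2 * ∑ K ∈ T.elements, (1 + 1 / α * AnisoMesh.indicator T F uh K) *
            (AnisoMesh.vol K *
              (AnisoMesh.pullback (FK K) (AnisoMesh.hessReg α zh K)).trace) ∧
        -- `M_K` is a metric tensor with `√(det M_K) = ρ_K`
        (∀ K ∈ T.elements, (AnisoMesh.metric T F uh zh α K).PosDef ∧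
          Real.sqrt (AnisoMesh.metric T F uh zh α K).det = AnisoMesh.rho T F uh zh α K) ∧
        -- the bound on aligned meshes
        (AnisoMesh.IsAligned T FK (AnisoMesh.metric T F uh zh α) →
          AnisoMesh.errorFunctional T F uh zh ≤
            C * α ^ 2 * AnisoMesh.anisoSum T F uh zh α) ∧
        -- the lower bound of its right-hand side, attained on equidistributed meshes
        AnisoMesh.sigma T (AnisoMesh.metric T F uh zh α) ^ (((d : ℝ) + 2) / d) *
            (T.numElements : ℝ) ^ (-(2 / (d : ℝ))) ≤ AnisoMesh.anisoSum T F uh zh α ∧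
        (AnisoMesh.IsEquidistributed T (AnisoMesh.metric T F uh zh α) →
          AnisoMesh.anisoSum T F uh zh α =
            AnisoMesh.sigma T (AnisoMesh.metric T F uh zh α) ^ (((d : ℝ) + 2) / d) *
              (T.numElements : ℝ) ^ (-(2 / (d : ℝ)))) ∧
        -- the final estimate
        (AnisoMesh.IsAligned T FK (AnisoMesh.metric T F uh zh α) →
          AnisoMesh.IsEquidistributed T (AnisoMesh.metric T F uh zh α) →
          AnisoMesh.errorFunctional T F uh zh ≤
            C * α ^ 2 * AnisoMesh.sigma T (AnisoMesh.metric T F uh zh α) ^ (((d : ℝ) + 2) / d) *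
              (T.numElements : ℝ) ^ (-(2 / (d : ℝ)))) := by
  have hd0 : (0 : ℝ) < d := by exact_mod_cast hd
  have hd1 : (1 : ℝ) ≤ d := by exact_mod_cast hd
  -- The sup bound needs only `½ diam²`; adding `1` makes positivity immediate.
  set c : ℝ := 1 / 2 * Metric.diam (cell Khat) ^ 2 + 1 with hc
  have hc0 : 0 < c := by positivity
  -- The factor `d` is spent only on aligned meshes, where the trace is `d` times a geometric mean;
  -- elsewhere `c ≤ d * c` suffices.
  refine ⟨d * c, by positivity, ?_⟩
  intro Ω _ _ T FK hFK F _ uh zh _ hz α hα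
  set η := indicator T F uh
  have hη0 : ∀ K, 0 ≤ η K := indicator_nonneg T F uh
  have hα' : 0 < 1 / α := one_div_pos.2 hα
  have hη1 : ∀ K, 0 < 1 + 1 / α * η K := fun K => by have := hη0 K; positivity
  have hpos : ∀ K : Finset (Pt d), (hessReg α zh K).PosDef := hessReg_posDef hα zh
  have hdet : ∀ K, 0 < (hessReg α zh K).det := fun K => (hpos K).det_pos
  have hvol : ∀ K : Finset (Pt d), 0 ≤ vol K := fun K => measureReal_nonneg
  have htr : ∀ K : Finset (Pt d), 0 ≤ (pullback (FK K) (absMat (hess zh K))).trace := fun K =>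
    (pullback_posSemidef _ (absMat_posSemidef _)).trace_nonneg
  -- the estimate with the Hessian, with the constant `c`
  have hE : errorFunctional T F uh zh ≤
      c * ∑ K ∈ T.elements, η K * (vol K * (pullback (FK K) (absMat (hess zh K))).trace) := by
    rw [Finset.mul_sum]
    refine Finset.sum_le_sum fun K hK => ?_
    refine (element_error_le hd F uh hK (mul_nonneg hc0.le (htr K)) fun x hx => ?_).trans_eq
      (by ring)
    refine (abs_le_of_mem_bubbleSpace hz.1 hK (hFK K hK) hx).trans ?_
    nlinarith [htr K]
  have hreg : ∀ K, (pullback (FK K) (absMat (hess zh K))).trace ≤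
      α * (pullback (FK K) (hessReg α zh K)).trace := fun K => by
    have h1 : 0 ≤ (pullback (FK K) (1 : Matrix (Fin d) (Fin d) ℝ)).trace :=
      (pullback_posSemidef _ Matrix.PosSemidef.one).trace_nonneg
    rw [hessReg, trace_pullback_add, pullback_smul, Matrix.trace_smul, smul_eq_mul, mul_add,
      ← mul_assoc, mul_one_div_cancel hα.ne', one_mul]
    nlinarith
  have hE3 : errorFunctional T F uh zh ≤
      c * α ^ 2 * ∑ K ∈ T.elements, (1 + 1 / α * η K) *
        (vol K * (pullback (FK K) (hessReg α zh K)).trace) := by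
    refine hE.trans ?_
    rw [mul_assoc]
    refine mul_le_mul_of_nonneg_left ?_ hc0.le
    rw [Finset.mul_sum]
    refine Finset.sum_le_sum fun K _ => ?_
    -- Two enlargements: `η_K ≤ α + η_K` and `|H_K| ≤ α H_{K,α}` under the trace. Each then releases
    -- one factor `α`.
    calc η K * (vol K * (pullback (FK K) (absMat (hess zh K))).trace)
        ≤ (α + η K) * (vol K * (α * (pullback (FK K) (hessReg α zh K)).trace)) :=
          mul_le_mul (by linarith) (mul_le_mul_of_nonneg_left (hreg K) (hvol K))
            (mul_nonneg (hvol K) (htr K)) (by linarith [hη0 K])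
      _ = _ := by field_simp
  have hsum3 : 0 ≤ ∑ K ∈ T.elements, (1 + 1 / α * η K) *
      (vol K * (pullback (FK K) (hessReg α zh K)).trace) :=
    Finset.sum_nonneg fun K _ => mul_nonneg (hη1 K).le <| mul_nonneg (hvol K)
      (pullback_posSemidef _ (hpos K).posSemidef).trace_nonneg
  have hcd : c ≤ d * c := by nlinarith
  have h3 : errorFunctional T F uh zh ≤
      d * c * α ^ 2 * ∑ K ∈ T.elements, (1 + 1 / α * η K) *
        (vol K * (pullback (FK K) (hessReg α zh K)).trace) :=
    hE3.trans (mul_le_mul_of_nonneg_right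
      (mul_le_mul_of_nonneg_right hcd (sq_nonneg α)) hsum3)
  have hrho : ∀ K, 0 < rho T F uh zh α K := fun K =>
    mul_pos (Real.rpow_pos_of_pos (hη1 K) _) (Real.rpow_pos_of_pos (hdet K) _)
  have hmet : ∀ K, (metric T F uh zh α K).PosDef ∧
      √(metric T F uh zh α K).det = rho T F uh zh α K := fun K =>
    posDef_smul_and_sqrt_det hd (hpos K) (hrho K)
  have hsig : sigma T (metric T F uh zh α) = ∑ K ∈ T.elements, rho T F uh zh α K * vol K :=
    Finset.sum_congr rfl fun K _ => by rw [(hmet K).2]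
  have hS : anisoSum T F uh zh α =
      ∑ K ∈ T.elements, (rho T F uh zh α K * vol K) ^ (((d : ℝ) + 2) / d) :=
    Finset.sum_congr rfl fun K _ =>
      (rho_mul_rpow hd (hη1 K).le (hdet K).le (hvol K)).symm
  have hp : 1 ≤ ((d : ℝ) + 2) / d := by rw [le_div_iff₀ hd0]; linarith
  -- With `p = (d+2)/d`, the power of `N` in the mean inequality is `-(p - 1)`.
  have hp' : -(2 / (d : ℝ)) = -(((d : ℝ) + 2) / d - 1) := by field_simp; ring
  have hnn : ∀ K ∈ T.elements, 0 ≤ rho T F uh zh α K * vol K := fun K _ =>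
    mul_nonneg (hrho K).le (hvol K)
  have h4 : IsAligned T FK (metric T F uh zh α) → errorFunctional T F uh zh ≤
      d * c * α ^ 2 * anisoSum T F uh zh α := fun hal => by
    refine hE3.trans_eq ?_
    rw [mul_comm (d : ℝ) c, mul_right_comm c (d : ℝ), mul_assoc _ (d : ℝ), anisoSum,
      Finset.mul_sum _ _ (d : ℝ)]
    refine congrArg _ (Finset.sum_congr rfl fun K hK => ?_)
    -- Since `|K̂| = 1`, the factor `|det F_K'|^{2/d}` from alignment is `|K|^{2/d}`, which joins
    -- `|K|` to form `|K|^{(d+2)/d}`.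
    have hV : vol K = |(jac (FK K)).det| := by
      rw [vol_image (FK K) (hFK K hK), hKhat.2.2, mul_one]
    have hVp : 0 < vol K := vol_pos (Triangulation.mem_elements.1 hK).2
      (Triangulation.affineIndependent hK)
    rw [trace_pullback_of_aligned hd (FK K) (hpos K)
      (mul_pos (Real.rpow_pos_of_pos (hrho K) _) (Real.rpow_pos_of_pos (hdet K) _)) (hal K hK),
      ← hV, add_div, div_self hd0.ne', Real.rpow_add hVp, Real.rpow_one]
    ring
  have h5 : IsEquidistributed T (metric T F uh zh α) → anisoSum T F uh zh α =
      sigma T (metric T F uh zh α) ^ (((d : ℝ) + 2) / d) *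
        (T.numElements : ℝ) ^ (-(2 / (d : ℝ))) := fun heq => by
    rw [hS, hsig, hp']
    refine sum_rpow_eq_of_forall_eq_average _ hp hnn fun K hK => ?_
    have := heq K hK
    rwa [(hmet K).2, hsig] at this
  refine ⟨hE.trans (mul_le_mul_of_nonneg_right hcd (Finset.sum_nonneg fun K _ =>
      mul_nonneg (hη0 K) (mul_nonneg (hvol K) (htr K)))), h3.trans_eq ?_, h3, fun K _ => hmet K,
    h4, ?_, h5, fun hal heq => ?_⟩
  -- The two regularized bounds agree term by term: `αI + |H_K| = α H_{K,α}` and `α + η_K = α (1 +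
  -- α⁻¹ η_K)`.
  · rw [mul_assoc, Finset.mul_sum]
    refine congrArg _ (Finset.sum_congr rfl fun K _ => ?_)
    have : α • (1 : Matrix (Fin d) (Fin d) ℝ) + absMat (hess zh K) = α • hessReg α zh K := by
      rw [hessReg, smul_add, smul_smul, mul_one_div_cancel hα.ne', one_smul]
    rw [this, pullback_smul, Matrix.trace_smul, smul_eq_mul]
    field_simp
  · rw [hS, hsig, hp']
    exact rpow_sum_mul_card_rpow_le_sum_rpow _ hp hnn
  · rw [mul_assoc, ← h5 heq]
    exact h4 hal
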